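/- Let $X$ be a set and let $F=F(X)$ be the free group on $X$. An \emph{$L$-presentation} $\langle X\mid Q\mid \Phi\mid R\rangle$ consists of subsets $Q,R\subseteq F$ and a set $\Phi\subseteq \mathrm{End}(F)$; it defines the group $F/K$, where $K$ is the normal closure in $F$ of $Q\cup\bigcup_{\sigma\in\Phi^*}\sigma(R)$ and $\Phi^*\subseteq \mathrm{End}(F)$ is the monoid of endomorphisms generated by $\Phi$. The $L$-presentation is \emph{finite} if $X$, $Q$, $\Phi$ and $R$ are finite, and \emph{invariant} if $\varphi(K)\subseteq K$ for every $\varphi\in\Phi$, i.e. if every $\varphi\in\Phi$ induces an endomorphism of $F/K$. A group is \emph{invariantly finitely $L$-presented} if it is isomorphic to the group defined by some finite invariant $L$-presentation. \textbf{Theorem.} Let $G$ be a finitely presented group and let $H\trianglelefteq G$ be a finitely generated normal subgroup. Suppose that $G$ splits over $H$, i.e. there is a subgroup $S\le G$ with $G=HS$ and $H\cap S=\{1\}$ (so that $G= H\rtimes S$). Then $H$ is invariantly finitely $L$-presented. -/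

import Mathlib

/-- An `L`-presentation `⟨X | Q | Φ | R⟩` over the alphabet `X`: fixed relations `Q` and iterated
relations `R` in the free group `F(X)`, and substitutions `Φ ⊆ End(F(X))`. -/
structure LPresentation (X : Type*) where
  /-- The fixed relations. -/
  fixedRels : Set (FreeGroup X)
  /-- The substitutions. -/
  substs : Set (Monoid.End (FreeGroup X))
  /-- The iterated relations. -/
  iteratedRels : Set (FreeGroup X)

namespace LPresentation

variable {X : Type*} (P : LPresentation X)

/-- The relations `Q ∪ ⋃_{σ ∈ Φ*} R^σ`, where `Φ*` is the submonoid of `End(F(X))` generated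
by `Φ`. -/
def rels : Set (FreeGroup X) :=
  P.fixedRels ∪ ⋃ σ ∈ Submonoid.closure P.substs, (fun r : FreeGroup X => σ r) '' P.iteratedRels

/-- The kernel of the free presentation: the normal closure of all relations in `F(X)`. -/
def kernel : Subgroup (FreeGroup X) :=
  Subgroup.normalClosure P.rels

/-- The group defined by an `L`-presentation. -/
abbrev PresGroup : Type _ :=
  PresentedGroup P.rels

/-- An `L`-presentation is finite if its generators, fixed relations, substitutions and iterated
relations have finite cardinality. -/
structure IsFinite : Prop where
  generators : Finite X
  fixedRels : P.fixedRels.Finite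
  substs : P.substs.Finite
  iteratedRels : P.iteratedRels.Finite

/-- An `L`-presentation is invariant if each substitution `φ ∈ Φ` induces an endomorphism of the
group it defines, that is, if the normal closure of the relations is `φ`-invariant. -/
def IsInvariant : Prop :=
  ∀ φ ∈ P.substs, ∀ g ∈ P.kernel, φ g ∈ P.kernel

end LPresentation

/-- A group is invariantly finitely `L`-presented if it is isomorphic to the group defined by some
finite invariant `L`-presentation. (The alphabet is finite, so it may be taken in `Type`.) -/
def IsInvariantlyFinitelyLPresented (G : Type*) [Group G] : Prop :=
  ∃ (X : Type) (P : LPresentation X), P.IsFinite ∧ P.IsInvariant ∧ Nonempty (G ≃* P.PresGroup)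

/-- `G` splits over its subgroup `H` if `H` has a complement `S` in `G`: every element of `G` is
uniquely a product `h * s` with `h ∈ H` and `s ∈ S`. For normal `H` this means `G = H ⋊ S`. -/
def SplitsOver {G : Type*} [Group G] (H : Subgroup G) : Prop :=
  ∃ S : Subgroup G, H.IsComplement' S

/-!
Let `ψ : F(I) → G` be a finite presentation of `G = H ⋊ S` and let `f : F(A) → G` have image `H`,
with `A` finite. The group `G` acts on the coset space `G / S`, which is identified with `H`: the
element `g = h * s` acts by the affine map `x ↦ h * (s * x * s⁻¹)`. For each letter `y` (a generator
of `F(I)` or the inverse of one), lift the affine map of `ψ y` to a map `x ↦ v y * φ y x` of `F(A)`,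
with `φ y` an endomorphism. The substitutions of the `L`-presentation are the `φ y`.

A word `L` in the letters acts on `F(A)` by the composite of the affine maps of its letters. If
`ψ L = f c`, then this composite agrees with left multiplication by `c` modulo `ker f`
(`apply_affineWord`). The agreement is expressed by finitely many relators, and the iterated
relators impose it for finitely many pairs `(L, c)`: `(r, 1)` for each relator `r` of `G`,
`(y y⁻¹, 1)` for each letter `y`, and `(L_a, a)` for each `a ∈ A`, where `L_a` is a word
with `ψ L_a = f a`. There are no fixed relators, so the kernel `K` is automatically invariant.

All the relators hold in `H`, so `K ≤ ker f`. Conversely, by the second family the letters act on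
`F(A) / K` by permutations, so `F(I)` acts; by the first family the action factors through `G`; by
the third, `f a ∈ G` acts as left multiplication by the class of `a`. Hence an element of `ker f`
acts trivially by left multiplication on `F(A) / K`, that is, lies in `K`.
-/

/-! ### Invariance and the kernel of an `L`-presentation without fixed relators -/

namespace LPresentation

variable {X : Type*} {P : LPresentation X}

theorem mem_kernel_of_mem_iteratedRels {r : FreeGroup X} (hr : r ∈ P.iteratedRels) :
    r ∈ P.kernel :=
  Subgroup.subset_normalClosure
    (Or.inr (Set.mem_biUnion (Submonoid.one_mem _) ⟨r, hr, rfl⟩))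

theorem isInvariant_of_fixedRels_eq_empty (hP : P.fixedRels = ∅) : P.IsInvariant := by
  intro φ hφ
  suffices h : P.kernel ≤ P.kernel.comap φ from fun g hg => h hg
  have : (P.kernel.comap φ).Normal := Subgroup.Normal.comap Subgroup.normalClosure_normal φ
  refine Subgroup.normalClosure_le_normal ?_
  intro g hg
  rw [rels, hP, Set.empty_union] at hg
  obtain ⟨σ, hσ, r, hr, rfl⟩ := Set.mem_iUnion₂.1 hg
  exact Subgroup.subset_normalClosure (Or.inr (Set.mem_biUnion
    (Submonoid.mul_mem _ (Submonoid.subset_closure hφ) hσ) ⟨r, hr, rfl⟩))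

theorem kernel_le_ker {G : Type*} [Group G] {f : FreeGroup X →* G} (hP : P.fixedRels = ∅)
    (hsubst : ∀ φ ∈ P.substs, ∀ x, f x = 1 → f (φ x) = 1)
    (hrel : ∀ r ∈ P.iteratedRels, f r = 1) : P.kernel ≤ f.ker := by
  have hclosure : ∀ σ ∈ Submonoid.closure P.substs, ∀ x, f x = 1 → f (σ x) = 1 := by
    intro σ hσ
    induction hσ using Submonoid.closure_induction with
    | mem φ hφ => exact hsubst φ hφ
    | one => exact fun x hx => hx
    | mul σ τ _ _ ihσ ihτ => exact fun x hx => ihσ _ (ihτ x hx)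
  refine Subgroup.normalClosure_le_normal ?_
  intro g hg
  rw [rels, hP, Set.empty_union] at hg
  obtain ⟨σ, hσ, r, hr, rfl⟩ := Set.mem_iUnion₂.1 hg
  exact hclosure σ hσ r (hrel r hr)

end LPresentation

/-! ### Words acting on a free group by affine maps -/

section AffineWord

variable {A Y G : Type*} [Group G] (v : Y → FreeGroup A) (φ : Y → Monoid.End (FreeGroup A))

/-- The action of a word on `F(A)` when each letter `y` acts by the affine map
`x ↦ v y * φ y x`; the last letter of the word acts first. -/
def affineWord (L : List Y) (x : FreeGroup A) : FreeGroup A :=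
  L.foldr (fun y z => v y * φ y z) x

@[simp]
theorem affineWord_nil (x : FreeGroup A) : affineWord v φ [] x = x := rfl

@[simp]
theorem affineWord_cons (y : Y) (L : List Y) (x : FreeGroup A) :
    affineWord v φ (y :: L) x = v y * φ y (affineWord v φ L x) := rfl

/-- The affine map of a word, split into its translation part and its linear part. -/
theorem affineWord_eq_mul (L : List Y) (x : FreeGroup A) :
    affineWord v φ L x = affineWord v φ L 1 * (L.map φ).prod x := by
  induction L with
  | nil => simp
  | cons y L ih =>
    rw [affineWord_cons, ih, map_mul, affineWord_cons, ← mul_assoc, List.map_cons, List.prod_cons]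
    rfl

/-- The `L`-presentation on the alphabet `A` with substitutions `φ y` whose iterated relators say,
for each pair `(L, c)` in `W`, that the word `L` acts as left multiplication by `c`: its translation
part is `c`, and its linear part fixes the generators. -/
def affinePresentation (W : Set (List Y × FreeGroup A)) : LPresentation A where
  fixedRels := ∅
  substs := Set.range φ
  iteratedRels := ⋃ w ∈ W, insert (affineWord v φ w.1 1 * w.2⁻¹)
    (Set.range fun a => (w.1.map φ).prod (FreeGroup.of a) * (FreeGroup.of a)⁻¹)

variable {v φ} {W : Set (List Y × FreeGroup A)}

theorem affinePresentation_isFinite [Finite A] [Finite Y] (hW : W.Finite) :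
    (affinePresentation v φ W).IsFinite where
  generators := inferInstance
  fixedRels := Set.finite_empty
  substs := Set.finite_range φ
  iteratedRels := hW.biUnion fun _ _ => (Set.finite_range _).insert _

theorem affinePresentation_isInvariant : (affinePresentation v φ W).IsInvariant :=
  LPresentation.isInvariant_of_fixedRels_eq_empty rfl

/-- In the presented group, the words in `W` act as prescribed. -/
theorem mk_affineWord {L : List Y} {c : FreeGroup A} (hL : (L, c) ∈ W) (x : FreeGroup A) :
    PresentedGroup.mk (affinePresentation v φ W).rels (affineWord v φ L x) =
      PresentedGroup.mk (affinePresentation v φ W).rels (c * x) := by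
  set m := PresentedGroup.mk (affinePresentation v φ W).rels with hm
  have hrel : ∀ r t, r * t⁻¹ ∈ insert (affineWord v φ L 1 * c⁻¹)
      (Set.range fun a => (L.map φ).prod (FreeGroup.of a) * (FreeGroup.of a)⁻¹) → m r = m t := by
    intro r t h
    rw [← mul_inv_eq_one, ← map_inv, ← map_mul]
    exact PresentedGroup.mk_eq_one_iff.2 (LPresentation.mem_kernel_of_mem_iteratedRels
      (P := affinePresentation v φ W) (Set.mem_biUnion hL h))
  have hlin : m.comp (L.map φ).prod = m :=
    FreeGroup.ext_hom _ _ fun a => hrel _ _ (Or.inr ⟨a, rfl⟩)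
  rw [affineWord_eq_mul, map_mul, map_mul, hrel _ _ (Or.inl rfl)]
  congr 1
  exact DFunLike.congr_fun hlin x

/-- The relators hold in `G` as soon as the affine maps are intertwined by `f` with left
multiplication by elements `γ y` on cosets of a subgroup `S` disjoint from the image of `f`. -/
theorem apply_affineWord {f : FreeGroup A →* G} {S : Subgroup G} (hS : Disjoint f.range S)
    {γ s : Y → G} (hs : ∀ y, s y ∈ S) (hγ : ∀ y, γ y = f (v y) * s y)
    (hφ : ∀ y x, f (φ y x) = s y * f x * (s y)⁻¹) {L : List Y} {c : FreeGroup A}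
    (hc : (L.map γ).prod = f c) (x : FreeGroup A) :
    f (affineWord v φ L x) = f (c * x) := by
  have key : ∀ L : List Y, (f (affineWord v φ L x))⁻¹ * ((L.map γ).prod * f x) ∈ S := by
    intro L
    induction L with
    | nil => simp
    | cons y L ih =>
      convert S.mul_mem (hs y) ih using 1
      simp only [affineWord_cons, List.map_cons, List.prod_cons, map_mul, hγ, hφ]
      group
  have h := key L
  rw [hc, ← map_mul, ← map_inv, ← map_mul] at h
  have h1 := Subgroup.disjoint_def.1 hS ⟨_, rfl⟩ h
  rwa [map_mul, map_inv, inv_mul_eq_one] at h1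

theorem affinePresentation_kernel_le {f : FreeGroup A →* G} {S : Subgroup G}
    (hS : Disjoint f.range S) {γ s : Y → G} (hs : ∀ y, s y ∈ S) (hγ : ∀ y, γ y = f (v y) * s y)
    (hφ : ∀ y x, f (φ y x) = s y * f x * (s y)⁻¹)
    (hW : ∀ w ∈ W, (w.1.map γ).prod = f w.2) :
    (affinePresentation v φ W).kernel ≤ f.ker := by
  refine LPresentation.kernel_le_ker rfl ?_ ?_
  · rintro _ ⟨y, rfl⟩ x hx
    simp [hφ, hx]
  · intro r hr
    obtain ⟨w, hw, rfl | ⟨a, rfl⟩⟩ := Set.mem_iUnion₂.1 hr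
    · have := apply_affineWord hS hs hγ hφ (hW w hw) 1
      simp_all
    · have h1 := apply_affineWord hS hs hγ hφ (hW w hw) 1
      have h2 := apply_affineWord hS hs hγ hφ (hW w hw) (FreeGroup.of a)
      rw [affineWord_eq_mul, map_mul, h1, mul_one, map_mul, mul_left_cancel_iff] at h2
      simp [h2]

end AffineWord

/-! ### The action of a free group on the presented group -/

section Action

variable {A I G : Type*} [Group G] {v : I × Bool → FreeGroup A}
  {φ : I × Bool → Monoid.End (FreeGroup A)} {W : Set (List (I × Bool) × FreeGroup A)}

/-- If `W` forces the letters `(i, b)` and `(i, !b)` to act inversely to each other, then `F(I)`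
acts on the presented group by permutations, each word acting as its affine map. -/
theorem exists_hom_perm (hinv : ∀ i b, ([(i, b), (i, !b)], 1) ∈ W) :
    ∃ θ : FreeGroup I →* Equiv.Perm (affinePresentation v φ W).PresGroup, ∀ L x,
      θ (FreeGroup.mk L) (PresentedGroup.mk _ x) = PresentedGroup.mk _ (affineWord v φ L x) := by
  set P := affinePresentation v φ W
  let m : FreeGroup A →* P.PresGroup := PresentedGroup.mk P.rels
  let e (y : I × Bool) : P.PresGroup →* P.PresGroup :=
    QuotientGroup.map _ _ (φ y) (affinePresentation_isInvariant (W := W) (φ y) ⟨y, rfl⟩)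
  have he : ∀ y x, m (v y) * e y (m x) = m (affineWord v φ [y] x) := fun y x => rfl
  have hcancel : ∀ i b q, m (v (i, b)) * e (i, b) (m (v (i, !b)) * e (i, !b) q) = q := by
    intro i b q
    obtain ⟨x, rfl⟩ := PresentedGroup.mk_surjective P.rels q
    refine (mk_affineWord (hinv i b) x).trans ?_
    rw [one_mul]
  let z (i : I) : Equiv.Perm P.PresGroup :=
    { toFun := fun q => m (v (i, true)) * e (i, true) q
      invFun := fun q => m (v (i, false)) * e (i, false) q
      left_inv := hcancel i false
      right_inv := hcancel i true }
  refine ⟨FreeGroup.lift z, fun L x => ?_⟩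
  induction L with
  | nil => rfl
  | cons y L ih =>
    rw [FreeGroup.lift_mk] at ih ⊢
    rw [List.map_cons, List.prod_cons, Equiv.Perm.mul_apply, ih]
    obtain ⟨i, _ | _⟩ := y <;> rfl

/-- If moreover `W` kills normal generators `R` of the kernel of `ψ`, and expresses each generator
of `A` as a word in `I`, then the relators of the presentation exhaust the kernel of `f`. -/
theorem ker_le_affinePresentation_kernel {ψ : FreeGroup I →* G} {f : FreeGroup A →* G}
    {R : Set (FreeGroup I)} (hR : Subgroup.normalClosure R = ψ.ker)
    (hinv : ∀ i b, ([(i, b), (i, !b)], 1) ∈ W)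
    (hrel : ∀ r ∈ R, ∃ L, FreeGroup.mk L = r ∧ (L, 1) ∈ W)
    (hgen : ∀ a, ∃ L, ψ (FreeGroup.mk L) = f (FreeGroup.of a) ∧ (L, FreeGroup.of a) ∈ W) :
    f.ker ≤ (affinePresentation v φ W).kernel := by
  set P := affinePresentation v φ W
  let m : FreeGroup A →* P.PresGroup := PresentedGroup.mk P.rels
  obtain ⟨θ, hθ⟩ :
      ∃ θ : FreeGroup I →* Equiv.Perm P.PresGroup, ∀ L x,
        θ (FreeGroup.mk L) (m x) = m (affineWord v φ L x) := exists_hom_perm hinv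
  have hθW : ∀ L c, (L, c) ∈ W →
      θ (FreeGroup.mk L) = MulAction.toPermHom P.PresGroup P.PresGroup (m c) := by
    intro L c h
    refine Equiv.ext fun q => ?_
    obtain ⟨x, rfl⟩ := PresentedGroup.mk_surjective _ q
    refine (hθ L x).trans ((mk_affineWord h x).trans ?_)
    rw [map_mul]
    rfl
  have hker : ψ.ker ≤ θ.ker := by
    rw [← hR]
    refine Subgroup.normalClosure_le_normal fun r hr => ?_
    obtain ⟨L, rfl, hL⟩ := hrel r hr
    exact (hθW L 1 hL).trans (by rw [map_one, map_one])
  choose word hψ hword using hgen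
  let t : FreeGroup A →* FreeGroup I := FreeGroup.lift fun a => FreeGroup.mk (word a)
  have hψt : ψ.comp t = f := FreeGroup.ext_hom _ _ fun a => by simp [t, hψ]
  have hθt : θ.comp t = (MulAction.toPermHom P.PresGroup P.PresGroup).comp m :=
    FreeGroup.ext_hom _ _ fun a => by simp [t, hθW _ _ (hword a)]
  intro x hx
  have h1 : θ (t x) = 1 := hker (by rwa [← hψt] at hx)
  have h2 := (DFunLike.congr_fun hθt x).symm.trans h1
  -- Left multiplication is faithful: evaluate at the identity.
  have h3 := Equiv.congr_fun h2 1
  refine PresentedGroup.mk_eq_one_iff.1 ?_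
  simpa using h3

end Action

theorem theoremC {G : Type*} [Group G] (hG : Group.IsFinitelyPresented G)
    (H : Subgroup G) (hnormal : H.Normal) (hfg : H.FG) (hsplit : SplitsOver H) :
    IsInvariantlyFinitelyLPresented H := by
  obtain ⟨n, ψ, hψ, R, hRfin, hR⟩ := hG.out
  obtain ⟨S, hS⟩ := hsplit
  obtain ⟨A, hA, f₀, hf₀⟩ := Group.fg_iff_exists_freeGroup_hom_surjective_finite.1
    ((Group.fg_iff_subgroup_fg H).2 hfg)
  let f : FreeGroup A →* G := H.subtype.comp f₀
  have hf : ∀ h ∈ H, ∃ x, f x = h := fun h hh =>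
    (hf₀ ⟨h, hh⟩).imp fun x hx => congrArg Subtype.val hx
  have hfH : ∀ x, f x ∈ H := fun x => (f₀ x).2
  have hdisj : Disjoint f.range S :=
    hS.disjoint.mono_left (by rintro _ ⟨x, rfl⟩; exact hfH x)
  let γ (y : Fin n × Bool) : G := ψ (FreeGroup.mk [y])
  have hγprod : ∀ L : List (Fin n × Bool), (L.map γ).prod = ψ (FreeGroup.mk L) := by
    intro L
    induction L with
    | nil => exact (map_one ψ).symm
    | cons y L ih => rw [List.map_cons, List.prod_cons, ih, ← map_mul, FreeGroup.mul_mk]; rfl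
  have hletter : ∀ y, ∃ v : FreeGroup A, ∃ s ∈ S, γ y = f v * s := by
    intro y
    obtain ⟨⟨h, s⟩, hhs, -⟩ := hS.existsUnique (γ y)
    obtain ⟨v, hv⟩ := hf h h.2
    exact ⟨v, s, s.2, by rw [hv]; exact hhs.symm⟩
  choose v s hs hγ using hletter
  have hconj : ∀ y a, ∃ x, f x = s y * f (FreeGroup.of a) * (s y)⁻¹ := fun y a =>
    hf _ (hnormal.conj_mem _ (hfH _) _)
  choose c hc using hconj
  let φ (y : Fin n × Bool) : Monoid.End (FreeGroup A) := FreeGroup.lift (c y)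
  have hφ : ∀ y x, f (φ y x) = s y * f x * (s y)⁻¹ := fun y x =>
    DFunLike.congr_fun (FreeGroup.ext_hom (f := f.comp (φ y))
      (g := (MulAut.conj (s y)).toMonoidHom.comp f) fun a => by simp [φ, hc]) x
  have hgen : ∀ a, ∃ L, ψ (FreeGroup.mk L) = f (FreeGroup.of a) := fun a => by
    obtain ⟨g, hg⟩ := hψ (f (FreeGroup.of a))
    exact ⟨g.toWord, by rw [FreeGroup.mk_toWord, hg]⟩
  choose word hword using hgen
  let W : Set (List (Fin n × Bool) × FreeGroup A) :=
    Set.range (fun y : Fin n × Bool => ([y, (y.1, !y.2)], 1)) ∪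
      (fun r : FreeGroup (Fin n) => (r.toWord, 1)) '' R ∪
      Set.range (fun a => (word a, FreeGroup.of a))
  have hWfin : W.Finite :=
    ((Set.finite_range _).union (hRfin.image _)).union (Set.finite_range _)
  have hW : ∀ w ∈ W, (w.1.map γ).prod = f w.2 := by
    rintro _ ((⟨⟨i, b⟩, rfl⟩ | ⟨r, hr, rfl⟩) | ⟨a, rfl⟩) <;> rw [hγprod]
    · have h : FreeGroup.mk [(i, b), (i, !b)] = 1 := Quot.sound FreeGroup.Red.Step.cons_not
      simp [h]
    · have hr' : r ∈ ψ.ker := hR ▸ Subgroup.subset_normalClosure hr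
      simpa [FreeGroup.mk_toWord] using hr'
    · exact hword a
  have hker : (affinePresentation v φ W).kernel = f₀.ker := by
    have hff₀ : f.ker = f₀.ker := MonoidHom.ker_comp_of_injective f₀ H.subtype H.subtype_injective
    rw [← hff₀]
    exact le_antisymm (affinePresentation_kernel_le hdisj hs hγ hφ hW)
      (ker_le_affinePresentation_kernel hR
        (fun i b => Or.inl (Or.inl ⟨(i, b), rfl⟩))
        (fun r hr => ⟨r.toWord, FreeGroup.mk_toWord, Or.inl (Or.inr ⟨r, hr, rfl⟩)⟩)
        (fun a => ⟨word a, hword a, Or.inr ⟨a, rfl⟩⟩))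
  exact ⟨A, affinePresentation v φ W, affinePresentation_isFinite hWfin,
    affinePresentation_isInvariant,
    ⟨(QuotientGroup.quotientKerEquivOfSurjective f₀ hf₀).symm.trans
      (QuotientGroup.quotientMulEquivOfEq hker.symm)⟩⟩
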